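/- Theorem. Let $\mathsf H$ be a real separable Hilbert space, $f\colon\mathsf H\to\mathbb R$ convex and Lipschitz continuous with constant $L>0$, and $\mathsf X\subset\mathsf H$ nonempty, closed and convex with $\operatorname{argmin}_{\mathsf X} f\neq\varnothing$; let $P_{\mathsf X}$ be the orthogonal projection onto $\mathsf X$. Let $\xi$ be a random variable and let $\hat u(\mathsf x,\xi)\in\mathsf H$ ($\mathsf x\in\mathsf X$), jointly measurable in both arguments, satisfy, for every $\mathsf x\in\mathsf X$, $$\mathbb E\|\hat u(\mathsf x,\xi)\|<+\infty,\qquad \mathbb E[\hat u(\mathsf x,\xi)]\in\partial f(\mathsf x),\qquad \mathbb E\big[\|\hat u(\mathsf x,\xi)-\mathbb E[\hat u(\mathsf x,\xi)]\|^p\big]\le\sigma^p,$$ for some $\sigma\ge 0$ and $p\in\,]1,2]$, where $\partial f(\mathsf x)=\{\mathsf u\in\mathsf H : f(\mathsf y)\ge f(\mathsf x)+\langle \mathsf u,\mathsf y-\mathsf x\rangle\ \forall \mathsf y\in\mathsf H\}$. Let $m\ge 1$ be an integer and let $\sigma_m\ge 0$ be such that, for every $\mathsf x\in\mathsf X$,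 the average $\bar u=\frac1m\sum_{j=1}^m\hat u(\mathsf x,\xi_j)$ over i.i.d. copies $\xi_1,\dots,\xi_m$ of $\xi$ satisfies $\mathbb E[\|\bar u-\mathbb E[\bar u]\|^p]\le\sigma_m^p$. Let $\gamma_k>0$ and $\lambda_k>0$ ($k=1,2,\dots$), let $\mathsf x_1\in\mathsf X$, and let $\xi^k_j$ ($k\ge1$, $1\le j\le m$) be copies of $\xi$ that are independent within each batch $(\xi^k_j)_{1\le j\le m}$, the batches being independent too. Consider the clipped stochastic subgradient method $x_1\equiv\mathsf x_1$ and, for $k=1,2,\dots$, $$\bar u_k=\frac1m\sum_{j=1}^m\hat u(x_k,\xi^k_j),\qquad \tilde u_k=\max\{\|\bar u_k\|/\lambda_k,1\}^{-1}\,\bar u_k,\qquad x_{k+1}=P_{\mathsf X}(x_k-\gamma_k\tilde u_k),$$ and set $\bar x_k=\frac1k\sum_{i=1}^k x_i$. Let $\varepsilon>0$ and suppose that $(\gamma_k)$ is decreasing, i.e. $\gamma_{k+1}\le\gamma_k$ for all $k$, and that $\lambda_k\ge L_\varepsilon:=(1+\varepsilon)L$ for all $k$. Let $\mathsf x_*\in\operatorname{argmin}_{\mathsf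 X}f$ and $f_*=\min_{\mathsf X}f$, and define $$a_p=\Big(1+\frac1\varepsilon\Big)^{p-1}\sigma_m^p,\qquad b_p=2^{p-1}(\sigma_m^p+L^p),$$ $$A_k=a_p\sum_{i=1}^k\frac{\gamma_i}{\lambda_i^{p-1}},\quad B_k=b_p\sum_{i=1}^k\gamma_i^2\lambda_i^{2-p},\quad C_k=\max_{1\le i\le k}\gamma_i\lambda_i,\quad D_k=\max_{1\le i\le k}\gamma_i^2\lambda_i^2,\quad E_k=b_p\sum_{i=1}^k\gamma_i^4\lambda_i^{4-p}.$$ Then for every $\delta\in\,]0,2/e]$ and every integer $k\ge1$, with probability at least $1-\delta$, $$f(\bar x_k)-f_*\le\frac1{2k\gamma_k}\bigg(\|\mathsf x_1-\mathsf x_*\|+A_k+B_k+\frac83\,(C_k+D_k)\log\frac2\delta+\big(\sqrt{B_k}+\sqrt{E_k}\big)\sqrt{\log\frac2\delta}\bigg)^2.$$ -/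

import Mathlib

open MeasureTheory ProbabilityTheory
open scoped BigOperators

namespace CSSGM

noncomputable section

/-- The convex subdifferential of a real function on a Hilbert space. -/
def subdifferential {H : Type*} [NormedAddCommGroup H] [InnerProductSpace ℝ H]
    (f : H → ℝ) (x : H) : Set H :=
  {u | ∀ y : H, f x + inner ℝ u (y - x) ≤ f y}

/-- A projection onto a nonempty closed convex set exists. -/
theorem exists_proj {H : Type*} [NormedAddCommGroup H] [InnerProductSpace ℝ H] [CompleteSpace H]
    {X : Set H} (hne : X.Nonempty) (hcl : IsClosed X) (hcv : Convex ℝ X) (x : H) :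
    ∃ p : H, p ∈ X ∧ ∀ y ∈ X, ‖x - p‖ ≤ ‖x - y‖ := by
  obtain ⟨v, hv, h⟩ := exists_norm_eq_iInf_of_complete_convex hne hcl.isComplete hcv x
  refine ⟨v, hv, fun y hy => ?_⟩
  rw [h]
  exact ciInf_le ⟨0, Set.forall_mem_range.2 fun _ => norm_nonneg _⟩ (⟨y, hy⟩ : X)

open Classical in
/-- The metric projection onto `X`: a point of `X` nearest to `x`. For nonempty closed convex `X`
in a Hilbert space there is exactly one such point (if there is none, the value is `x`). -/
def proj {H : Type*} [NormedAddCommGroup H] (X : Set H) (x : H) : H :=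
  if h : ∃ p : H, p ∈ X ∧ ∀ y ∈ X, ‖x - p‖ ≤ ‖x - y‖ then h.choose else x

theorem proj_spec {H : Type*} [NormedAddCommGroup H] [InnerProductSpace ℝ H] [CompleteSpace H]
    {X : Set H} (hne : X.Nonempty) (hcl : IsClosed X) (hcv : Convex ℝ X) (x : H) :
    proj X x ∈ X ∧ ∀ y ∈ X, ‖x - proj X x‖ ≤ ‖x - y‖ := by
  have h := exists_proj hne hcl hcv x
  rw [proj, dif_pos h]
  exact h.choose_spec

/-- The clipping operator `CLIP(u, l) = max{‖u‖ / l, 1}⁻¹ u`. -/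
def clip {H : Type*} [NormedAddCommGroup H] [NormedSpace ℝ H] (u : H) (l : ℝ) : H :=
  (max (‖u‖ / l) 1)⁻¹ • u

/-- The minibatch average `(1/m) ∑_j û(x, z_j)`. -/
def batchMean {H Ξ : Type*} [NormedAddCommGroup H] [NormedSpace ℝ H] {m : ℕ}
    (uhat : H → Ξ → H) (x : H) (z : Fin m → Ξ) : H :=
  (1 / (m : ℝ)) • ∑ j, uhat x (z j)

/-- The iterates `x_k`, `k ≥ 1`, of the clipped stochastic subgradient method with steps `γ k`,
clipping levels `lam k` and draws `ξs k 1, …, ξs k m` for `k ≥ 1`. The indices start from `1`;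
the value at index `0` plays no role. -/
def iterate {H Ξ Ω : Type*} [NormedAddCommGroup H] [NormedSpace ℝ H] {m : ℕ}
    (X : Set H) (uhat : H → Ξ → H) (γ lam : ℕ → ℝ) (x₁ : H) (ξs : ℕ → Fin m → Ω → Ξ) :
    ℕ → Ω → H
  | 0 => fun _ => x₁
  | 1 => fun _ => x₁
  | (k + 2) => fun ω =>
      let x := iterate X uhat γ lam x₁ ξs (k + 1) ω
      proj X (x - γ (k + 1) •
        clip (batchMean uhat x (fun j => ξs (k + 1) j ω)) (lam (k + 1)))

/-- The averaged iterate `(1/k) ∑_{i=1}^k x_i`. -/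
def avgIterate {H Ξ Ω : Type*} [NormedAddCommGroup H] [NormedSpace ℝ H] {m : ℕ}
    (X : Set H) (uhat : H → Ξ → H) (γ lam : ℕ → ℝ) (x₁ : H) (ξs : ℕ → Fin m → Ω → Ξ)
    (k : ℕ) (ω : Ω) : H :=
  (1 / (k : ℝ)) • ∑ i ∈ Finset.Icc 1 k, iterate X uhat γ lam x₁ ξs i ω

/-- `a_p = (1 + 1/ε)^(p-1) σ_m^p`. -/
def aConst (p ε σm : ℝ) : ℝ := (1 + 1 / ε) ^ (p - 1) * σm ^ p

/-- `b_p = 2^(p-1) (σ_m^p + L^p)`. -/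
def bConst (p L σm : ℝ) : ℝ := (2 : ℝ) ^ (p - 1) * (σm ^ p + L ^ p)

/-- `A_k = a_p ∑_{i=1}^k γ_i / λ_i^(p-1)`. -/
def seqA (p ε σm : ℝ) (γ lam : ℕ → ℝ) (k : ℕ) : ℝ :=
  aConst p ε σm * ∑ i ∈ Finset.Icc 1 k, γ i / lam i ^ (p - 1)

/-- `B_k = b_p ∑_{i=1}^k γ_i^2 λ_i^(2-p)`. -/
def seqB (p L σm : ℝ) (γ lam : ℕ → ℝ) (k : ℕ) : ℝ :=
  bConst p L σm * ∑ i ∈ Finset.Icc 1 k, γ i ^ 2 * lam i ^ (2 - p)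

/-- `C_k = max_{1 ≤ i ≤ k} γ_i λ_i`. -/
def seqC (γ lam : ℕ → ℝ) (k : ℕ) (hk : 1 ≤ k) : ℝ :=
  (Finset.Icc 1 k).sup' (Finset.nonempty_Icc.mpr hk) (fun i => γ i * lam i)

/-- `D_k = max_{1 ≤ i ≤ k} γ_i^2 λ_i^2`. -/
def seqD (γ lam : ℕ → ℝ) (k : ℕ) (hk : 1 ≤ k) : ℝ :=
  (Finset.Icc 1 k).sup' (Finset.nonempty_Icc.mpr hk) (fun i => γ i ^ 2 * lam i ^ 2)

/-- `E_k = b_p ∑_{i=1}^k γ_i^4 λ_i^(4-p)`. -/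
def seqE (p L σm : ℝ) (γ lam : ℕ → ℝ) (k : ℕ) : ℝ :=
  bConst p L σm * ∑ i ∈ Finset.Icc 1 k, γ i ^ 4 * lam i ^ (4 - p)

end

end CSSGM

/-!
Clipping at a level above `L` trades variance for bias: given the iterate, the squared clipped
norms have mean at most `b_p λ ^ (2 - p)`, and along any direction the clipped gradient is off by at
most `a_p / λ ^ (p - 1)` in the mean. Both errors are bounded by multiples of `λ`, so exponential
supermartingales give Bernstein-type tail bounds for their weighted sums without any assumption on
the tails of the noise.

A projected step decreases `‖x_k - x_*‖ ^ 2` up to a quadratic error and the inner product of the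
noise with `x_k - x_*`. No a priori bound on `‖x_k - x_*‖` is available, so that inner product is
divided by the square root of the accumulated potential: the resulting direction has norm at most
one and depends only on the past, and the concavity of `√` turns the descent inequality into an
additive one for the root of the potential.
-/

namespace CSSGM

section RealInequalities

theorem exp_le_one_add_add_sq {x : ℝ} (hx : |x| ≤ 6 / 5) :
    Real.exp x ≤ 1 + x + 5 / 6 * x ^ 2 := by
  -- `Real.exp_bound` needs an argument in `[-1, 1]`, so bound `exp (x / 2)` and square.
  obtain ⟨y, rfl⟩ : ∃ y, x = 2 * y := ⟨x / 2, by ring⟩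
  have hy : |y| ≤ 3 / 5 := by
    rw [abs_mul, abs_two] at hx; linarith
  have hexp : Real.exp y ≤ 1 + y + 19 / 30 * y ^ 2 := by
    have htaylor := (abs_le.1 (Real.exp_bound (x := y) (by linarith) (n := 3) (by norm_num))).2
    norm_num [Finset.sum_range_succ, Nat.factorial] at htaylor
    have hcube : |y| ^ 3 ≤ 3 / 5 * y ^ 2 := by
      rw [pow_succ, sq_abs]; nlinarith [sq_nonneg y]
    linarith
  obtain ⟨hy_lower, hy_upper⟩ := abs_le.1 hy
  calc Real.exp (2 * y) = Real.exp y ^ 2 := by rw [two_mul, Real.exp_add, sq]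
    _ ≤ (1 + y + 19 / 30 * y ^ 2) ^ 2 := pow_le_pow_left₀ (Real.exp_pos y).le hexp 2
    _ ≤ 1 + 2 * y + 5 / 6 * (2 * y) ^ 2 := by
      nlinarith [mul_nonneg (sq_nonneg y) (sub_nonneg.2 hy_upper),
        mul_nonneg (sq_nonneg y)
          (mul_nonneg (sub_nonneg.2 hy_upper) (by linarith : (0 : ℝ) ≤ y + 3 / 5))]

theorem exp_le_one_add_mul_one_add {x y : ℝ} (hx0 : 0 ≤ x) (hxy : x ≤ y) (hx1 : x ≤ 1) :
    Real.exp x ≤ 1 + x * (1 + y) := by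
  have hexp := (abs_le.1 (Real.abs_exp_sub_one_sub_id_le (abs_le.2 ⟨by linarith, hx1⟩))).2
  nlinarith

theorem sq_le_rpow_two_sub_mul_rpow {s t p : ℝ} (hs : 0 ≤ s) (hst : s ≤ t) (hp0 : p ≠ 0)
    (hp2 : p ≤ 2) : s ^ 2 ≤ t ^ (2 - p) * s ^ p := by
  rcases hs.eq_or_lt with rfl | hs
  · simp [Real.zero_rpow hp0]
  calc s ^ 2 = s ^ (2 - p) * s ^ p := by rw [← Real.rpow_add hs, sub_add_cancel, Real.rpow_two]
    _ ≤ t ^ (2 - p) * s ^ p := by gcongr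

theorem le_rpow_one_sub_mul_rpow {s t p : ℝ} (ht : 0 < t) (hts : t ≤ s) (hp : 1 ≤ p) :
    s ≤ t ^ (1 - p) * s ^ p := by
  have hs : 0 < s := ht.trans_le hts
  calc s = s ^ (1 - p) * s ^ p := by rw [← Real.rpow_add hs, sub_add_cancel, Real.rpow_one]
    _ ≤ t ^ (1 - p) * s ^ p :=
      mul_le_mul_of_nonneg_right (Real.rpow_le_rpow_of_nonpos ht hts (by linarith)) (by positivity)

theorem add_rpow_le_two_rpow_mul {a b p : ℝ} (ha : 0 ≤ a) (hb : 0 ≤ b) (hp : 1 ≤ p) :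
    (a + b) ^ p ≤ 2 ^ (p - 1) * (a ^ p + b ^ p) := by
  lift a to NNReal using ha
  lift b to NNReal using hb
  exact_mod_cast NNReal.rpow_add_le_mul_rpow_add_rpow a b hp

theorem mul_add_sq_div_le {l κ s w z : ℝ} (hl : 0 < l) (hκ : 0 ≤ κ) (hz : |z| ≤ l) (hw : |w| ≤ l)
    (hκs : κ * l ≤ s) (hs : |κ * z + (z - w)| ≤ s) : κ * z + (z - w) ^ 2 / (2 * l) ≤ s := by
  obtain ⟨hs_lower, hs_upper⟩ := abs_le.1 hs
  obtain ⟨-, hz_upper⟩ := abs_le.1 hz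
  obtain ⟨-, hw_upper⟩ := abs_le.1 hw
  have hsq : (z - w) ^ 2 / (2 * l) ≤ |z - w| := by
    rw [div_le_iff₀ (by positivity), ← sq_abs]
    nlinarith [abs_sub z w, abs_nonneg (z - w)]
  rcases le_total 0 (z - w) with hzw | hzw
  · rw [abs_of_nonneg hzw] at hsq
    linarith
  rw [abs_of_nonpos hzw] at hsq
  rcases le_total z 0 with hz0 | hz0
  · linarith [mul_nonpos_of_nonneg_of_nonpos hκ hz0]
  · have hκz : κ * z * l ≤ s * z := by nlinarith
    have hsq' : (z - w) ^ 2 ≤ (s + κ * z) * (l - z) := by nlinarith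
    have hbound : κ * z * (2 * l) + (z - w) ^ 2 ≤ s * (2 * l) := by
      refine le_of_mul_le_mul_right ?_ hl
      nlinarith [mul_nonneg ((mul_nonneg hκ hl.le).trans hκs) (sq_nonneg (l - z))]
    rw [← le_sub_iff_add_le', div_le_iff₀ (by positivity)]
    linarith

theorem exists_rate_one_add_mul_add_le {B C t : ℝ} (hB : 0 ≤ B) (hC : 0 < C) (ht : 0 < t) :
    ∃ x, 0 < x ∧ x ≤ 1 ∧ (1 + x) * B + t / (x / C ^ 2) ≤ (√B + C * √t) ^ 2 := by
  obtain ⟨b, hb, rfl⟩ : ∃ b, 0 ≤ b ∧ B = b ^ 2 := ⟨√B, Real.sqrt_nonneg B, (Real.sq_sqrt hB).symm⟩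
  obtain ⟨r, hr, rfl⟩ : ∃ r, 0 < r ∧ t = r ^ 2 :=
    ⟨√t, Real.sqrt_pos.2 ht, (Real.sq_sqrt ht.le).symm⟩
  rw [Real.sqrt_sq hb, Real.sqrt_sq hr.le]
  have hCr : 0 < C * r := mul_pos hC hr
  -- The minimiser of the left side over `x > 0` is `C * r / b`.
  rcases le_or_gt b (C * r) with h | h
  · refine ⟨1, one_pos, le_rfl, ?_⟩
    field_simp
    nlinarith
  · have hb' : 0 < b := hCr.trans h
    refine ⟨C * r / b, by positivity, (div_le_one hb').2 h.le, ?_⟩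
    have heq : (1 + C * r / b) * b ^ 2 + r ^ 2 / (C * r / b / C ^ 2)
        = b ^ 2 + 2 * (b * (C * r)) := by
      field_simp
      ring
    rw [heq]
    nlinarith

theorem sqrt_add_le_sqrt_add_div {a b : ℝ} (ha : 0 ≤ a) (hab : 0 ≤ a + b) (h0 : a = 0 → b = 0) :
    √(a + b) ≤ √a + b / (2 * √a) := by
  rcases ha.eq_or_lt with rfl | ha
  · simp [h0 rfl]
  have hsq := Real.sq_sqrt ha.le
  have : 0 < √a := Real.sqrt_pos.2 ha
  have hrw : √a + b / (2 * √a) = (2 * a + b) / (2 * √a) := by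
    field_simp
    rw [hsq]
    ring
  rw [hrw, Real.sqrt_le_iff, div_pow, mul_pow, hsq]
  refine ⟨div_nonneg (by linarith) (by positivity), ?_⟩
  rw [le_div_iff₀ (by positivity)]
  nlinarith [sq_nonneg b]

theorem sqrt_add_sum_le {a : ℝ} {b : ℕ → ℝ} {N : ℕ}
    (hnonneg : ∀ n ≤ N, 0 ≤ a + ∑ i ∈ Finset.range n, b i)
    (hzero : ∀ n < N, a + ∑ i ∈ Finset.range n, b i = 0 → b n = 0) :
    √(a + ∑ i ∈ Finset.range N, b i)
      ≤ √a + ∑ n ∈ Finset.range N, b n / (2 * √(a + ∑ i ∈ Finset.range n, b i)) := by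
  have hstep : ∀ n ∈ Finset.range N,
      √(a + ∑ i ∈ Finset.range (n + 1), b i) - √(a + ∑ i ∈ Finset.range n, b i)
        ≤ b n / (2 * √(a + ∑ i ∈ Finset.range n, b i)) := fun n hn => by
    have hn := Finset.mem_range.1 hn
    have hnext := hnonneg (n + 1) hn
    rw [Finset.sum_range_succ, ← add_assoc] at hnext ⊢
    linarith [sqrt_add_le_sqrt_add_div (hnonneg n hn.le) hnext (hzero n hn)]
  have htel := Finset.sum_le_sum hstep
  rw [Finset.sum_range_sub fun n => √(a + ∑ i ∈ Finset.range n, b i)] at htel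
  simp only [Finset.range_zero, Finset.sum_empty, add_zero] at htel
  linarith

theorem add_mul_add_sqrt_le {r A B C D E t : ℝ} (hB : 0 ≤ B) (hC : 0 ≤ C) (hD : 0 ≤ D)
    (ht : 1 ≤ t) :
    r + A + √B + C * (5 / 3 * t + √t)
      ≤ r + A + B + 8 / 3 * (C + D) * t + (√B + √E) * √t := by
  have hroot : 1 ≤ √t := Real.one_le_sqrt.2 ht
  have hroot_le : √t ≤ t := by
    nth_rewrite 2 [← Real.mul_self_sqrt (zero_le_one.trans ht)]
    exact le_mul_of_one_le_left (Real.sqrt_nonneg t) hroot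
  linarith [mul_le_mul_of_nonneg_left hroot_le hC,
    le_mul_of_one_le_right (Real.sqrt_nonneg B) hroot, mul_nonneg (Real.sqrt_nonneg E)
      (Real.sqrt_nonneg t), mul_nonneg hD (zero_le_one.trans ht)]

end RealInequalities

section Clip

variable {H : Type*} [NormedAddCommGroup H]

section NormedSpace

variable [NormedSpace ℝ H]

theorem clip_of_norm_le {u : H} {l : ℝ} (hl : 0 < l) (hu : ‖u‖ ≤ l) : clip u l = u := by
  rw [clip, max_eq_right ((div_le_one hl).2 hu), inv_one, one_smul]

theorem norm_clip {u : H} {l : ℝ} (hl : 0 < l) : ‖clip u l‖ = min ‖u‖ l := by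
  rcases le_total ‖u‖ l with h | h
  · rw [clip_of_norm_le hl h, min_eq_left h]
  · have hu : 0 < ‖u‖ := hl.trans_le h
    rw [clip, max_eq_left ((one_le_div hl).2 h), min_eq_right h, inv_div, norm_smul,
      Real.norm_of_nonneg (by positivity), div_mul_cancel₀ _ hu.ne']

theorem norm_clip_le {u : H} {l : ℝ} (hl : 0 < l) : ‖clip u l‖ ≤ l :=
  (norm_clip hl).trans_le (min_le_right _ _)

theorem norm_clip_le_norm {u : H} {l : ℝ} (hl : 0 < l) : ‖clip u l‖ ≤ ‖u‖ :=
  (norm_clip hl).trans_le (min_le_left _ _)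

theorem sub_clip (u : H) (l : ℝ) : u - clip u l = (max (‖u‖ / l) 1 - 1) • clip u l := by
  have hmax : max (‖u‖ / l) 1 ≠ 0 := (zero_lt_one.trans_le (le_max_right _ _)).ne'
  rw [sub_smul, one_smul, clip, smul_inv_smul₀ hmax]

theorem continuous_clip (l : ℝ) : Continuous fun u : H => clip u l := by
  refine Continuous.smul (Continuous.inv₀ (by fun_prop) fun u => ?_) continuous_id
  exact (zero_lt_one.trans_le (le_max_right _ _)).ne'

theorem norm_clip_sq_le {u v : H} {l L p : ℝ} (hl : 0 < l) (hv : ‖v‖ ≤ L)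
    (hp1 : 1 ≤ p) (hp2 : p ≤ 2) :
    ‖clip u l‖ ^ 2 ≤ 2 ^ (p - 1) * (‖u - v‖ ^ p + L ^ p) * l ^ (2 - p) := by
  have hL : 0 ≤ L := (norm_nonneg v).trans hv
  have : 0 ≤ p := by linarith
  have hu : ‖u‖ ≤ ‖u - v‖ + L := by linarith [norm_sub_norm_le u v]
  calc ‖clip u l‖ ^ 2 ≤ l ^ (2 - p) * ‖clip u l‖ ^ p :=
        sq_le_rpow_two_sub_mul_rpow (norm_nonneg _) (norm_clip_le hl) (by linarith) hp2
    _ ≤ l ^ (2 - p) * (‖u - v‖ + L) ^ p := by gcongr; exact (norm_clip_le_norm hl).trans hu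
    _ ≤ l ^ (2 - p) * (2 ^ (p - 1) * (‖u - v‖ ^ p + L ^ p)) := by
        gcongr; exact add_rpow_le_two_rpow_mul (norm_nonneg _) hL hp1
    _ = _ := mul_comm _ _

end NormedSpace

variable [InnerProductSpace ℝ H]

theorem abs_inner_le_norm_of_norm_le_one (w : H) {e : H} (he : ‖e‖ ≤ 1) : |inner ℝ w e| ≤ ‖w‖ :=
  (abs_real_inner_le_norm w e).trans (mul_le_of_le_one_right (norm_nonneg _) he)

theorem inner_sub_clip_add_sq_div_le {u v e : H} {l : ℝ} (hl : 0 < l) (hv : ‖v‖ ≤ l)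
    (he : ‖e‖ ≤ 1) :
    inner ℝ (u - clip u l) e + inner ℝ (clip u l - v) e ^ 2 / (2 * l) ≤ ‖u - v‖ := by
  have hexcess : (max (‖u‖ / l) 1 - 1) * l ≤ ‖u - v‖ := by
    rw [sub_mul, max_mul_of_nonneg _ _ hl.le, div_mul_cancel₀ _ hl.ne', one_mul,
      sub_le_iff_le_add, max_le_iff]
    exact ⟨by linarith [norm_sub_norm_le u v], by linarith [norm_nonneg (u - v)]⟩
  have hinner : (max (‖u‖ / l) 1 - 1) * inner ℝ (clip u l) e
      + (inner ℝ (clip u l) e - inner ℝ v e) = inner ℝ (u - v) e := by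
    rw [← real_inner_smul_left, ← sub_clip, ← inner_sub_left, ← inner_add_left,
      sub_add_sub_cancel]
  rw [sub_clip, real_inner_smul_left, inner_sub_left]
  exact mul_add_sq_div_le hl (sub_nonneg.2 (le_max_right _ _))
    ((abs_inner_le_norm_of_norm_le_one _ he).trans (norm_clip_le hl))
    ((abs_inner_le_norm_of_norm_le_one _ he).trans hv) hexcess
    (hinner ▸ abs_inner_le_norm_of_norm_le_one _ he)

theorem inner_sub_clip_add_sq_div_le_rpow {u v e : H} {l t p : ℝ} (ht : 0 < t)
    (hvt : ‖v‖ + t ≤ l) (he : ‖e‖ ≤ 1) (hp1 : 1 ≤ p) (hp2 : p ≤ 2) :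
    inner ℝ (u - clip u l) e + inner ℝ (clip u l - v) e ^ 2 / (2 * l)
      ≤ t ^ (1 - p) * ‖u - v‖ ^ p := by
  have htl : t ≤ l := by linarith [norm_nonneg v]
  have hl : 0 < l := ht.trans_le htl
  rcases le_total t ‖u - v‖ with h | h
  · exact (inner_sub_clip_add_sq_div_le hl (by linarith) he).trans
      (le_rpow_one_sub_mul_rpow ht h hp1)
  have hu : ‖u‖ ≤ l := by linarith [norm_sub_norm_le u v]
  rw [clip_of_norm_le hl hu, sub_self, inner_zero_left, zero_add]
  calc inner ℝ (u - v) e ^ 2 / (2 * l) ≤ ‖u - v‖ ^ 2 / t := by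
        rw [← sq_abs]
        gcongr
        · exact abs_inner_le_norm_of_norm_le_one _ he
        · linarith
    _ ≤ t ^ (2 - p) * ‖u - v‖ ^ p / t := by
        gcongr
        exact sq_le_rpow_two_sub_mul_rpow (norm_nonneg _) h (by linarith) hp2
    _ = t ^ (1 - p) * ‖u - v‖ ^ p := by
        rw [mul_div_right_comm, ← Real.rpow_sub_one ht.ne']
        ring_nf

end Clip

section Moments

theorem integrable_rpow_norm_of_lintegral_le {E H : Type*} [NormedAddCommGroup H]
    [MeasurableSpace E] {ν : Measure E} {n : E → H} (hn : AEStronglyMeasurable n ν)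
    {p c : ℝ} (hp : 0 ≤ p) (hc : 0 ≤ c) (h : ∫⁻ z, ‖n z‖ₑ ^ p ∂ν ≤ ENNReal.ofReal c) :
    Integrable (fun z => ‖n z‖ ^ p) ν ∧ ∫ z, ‖n z‖ ^ p ∂ν ≤ c := by
  have henorm : ∀ z, ‖n z‖ₑ ^ p = ENNReal.ofReal (‖n z‖ ^ p) := fun z => by
    rw [← ofReal_norm, ENNReal.ofReal_rpow_of_nonneg (norm_nonneg _) hp]
  simp only [henorm] at h
  have hmeas : AEStronglyMeasurable (fun z => ‖n z‖ ^ p) ν :=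
    (hn.norm.aemeasurable.pow_const p).aestronglyMeasurable
  have hnonneg : 0 ≤ᵐ[ν] fun z => ‖n z‖ ^ p := ae_of_all _ fun z => by positivity
  have hint : Integrable (fun z => ‖n z‖ ^ p) ν :=
    (lintegral_ofReal_ne_top_iff_integrable hmeas hnonneg).1
      (h.trans_lt ENNReal.ofReal_lt_top).ne
  refine ⟨hint, ?_⟩
  rwa [← ofReal_integral_eq_lintegral_ofReal hint hnonneg, ENNReal.ofReal_le_ofReal_iff hc] at h

theorem lintegral_ofReal_exp_le {E : Type*} [MeasurableSpace E] {ν : Measure E}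
    [IsProbabilityMeasure ν] {h k : E → ℝ} (hk : Integrable k ν)
    (hle : ∀ z, Real.exp (h z) ≤ 1 + k z) {c : ℝ} (hc : ∫ z, k z ∂ν ≤ c) :
    ∫⁻ z, ENNReal.ofReal (Real.exp (h z)) ∂ν ≤ ENNReal.ofReal (Real.exp c) := by
  have hint : Integrable (fun z => 1 + k z) ν := (integrable_const 1).add hk
  calc ∫⁻ z, ENNReal.ofReal (Real.exp (h z)) ∂ν ≤ ∫⁻ z, ENNReal.ofReal (1 + k z) ∂ν :=
        lintegral_mono fun z => ENNReal.ofReal_le_ofReal (hle z)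
    _ = ENNReal.ofReal (∫ z, (1 + k z) ∂ν) :=
        (ofReal_integral_eq_lintegral_ofReal hint
          (ae_of_all _ fun z => (Real.exp_pos _).le.trans (hle z))).symm
    _ ≤ _ := by
        refine ENNReal.ofReal_le_ofReal ?_
        rw [integral_add (integrable_const 1) hk, integral_const, probReal_univ, one_smul]
        linarith [Real.add_one_le_exp c]

variable {H : Type*} [NormedAddCommGroup H] {Ω : Type*} [MeasurableSpace Ω]

/-- The standing assumption on one stochastic (sub)gradient `v`: it is integrable, its mean has
norm at most `L`, and its central moment of order `p` is at most `s ^ p`. -/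
structure HasBoundedNoise [NormedSpace ℝ H] (v : Ω → H) (L p s : ℝ) (P : Measure Ω) : Prop where
  integrable : Integrable v P
  norm_integral_le : ‖∫ ω, v ω ∂P‖ ≤ L
  lintegral_enorm_sub_rpow_le : ∫⁻ ω, ‖v ω - ∫ ω', v ω' ∂P‖ₑ ^ p ∂P ≤ ENNReal.ofReal (s ^ p)

theorem HasBoundedNoise.integrable_rpow [NormedSpace ℝ H] {P : Measure Ω} {v : Ω → H}
    {L p s : ℝ} (h : HasBoundedNoise v L p s P) (hp : 0 ≤ p) (hs : 0 ≤ s) :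
    Integrable (fun ω => ‖v ω - ∫ ω', v ω' ∂P‖ ^ p) P ∧
      ∫ ω, ‖v ω - ∫ ω', v ω' ∂P‖ ^ p ∂P ≤ s ^ p :=
  integrable_rpow_norm_of_lintegral_le
    (h.integrable.aestronglyMeasurable.sub aestronglyMeasurable_const) hp (by positivity)
    h.lintegral_enorm_sub_rpow_le

variable [InnerProductSpace ℝ H]

theorem exp_mul_inner_sub_clip_le {u v e : H} {l t p τ : ℝ} (ht : 0 < t) (hvt : ‖v‖ + t ≤ l)
    (he : ‖e‖ ≤ 1) (hp1 : 1 ≤ p) (hp2 : p ≤ 2) (hτ : 0 ≤ τ) (hτl : τ * l ≤ 3 / 5) :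
    Real.exp (τ * inner ℝ (v - clip u l) e)
      ≤ 1 + τ * (t ^ (1 - p) * ‖u - v‖ ^ p - inner ℝ (u - v) e) := by
  have hl : 0 < l := by linarith [norm_nonneg v]
  have hbias := inner_sub_clip_add_sq_div_le_rpow (u := u) ht hvt he hp1 hp2
  have hsplit : inner ℝ (u - clip u l) e = inner ℝ (u - v) e - inner ℝ (clip u l - v) e := by
    rw [← inner_sub_left, sub_sub_sub_cancel_right]
  rw [hsplit] at hbias
  rw [← neg_sub, inner_neg_left]
  have hle : |inner ℝ (clip u l - v) e| ≤ 2 * l := by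
    refine (abs_inner_le_norm_of_norm_le_one _ he).trans ((norm_sub_le _ _).trans ?_)
    linarith [norm_clip_le (u := u) hl]
  generalize inner ℝ (clip u l - v) e = y at hle hbias ⊢
  have hexp := exp_le_one_add_add_sq (x := τ * -y) (by
    rw [abs_mul, abs_neg, abs_of_nonneg hτ]
    nlinarith)
  have hquad : 5 / 6 * (τ * -y) ^ 2 ≤ τ * (y ^ 2 / (2 * l)) := by
    have heq : 5 / 6 * (τ * -y) ^ 2 = τ * (y ^ 2 / (2 * l)) * (5 / 3 * (τ * l)) := by
      field_simp
      ring
    rw [heq]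
    exact mul_le_of_le_one_right (by positivity) (by linarith)
  nlinarith [mul_le_mul_of_nonneg_left hbias hτ]

namespace HasBoundedNoise

variable {P : Measure Ω} [IsProbabilityMeasure P] {v : Ω → H} {L p s : ℝ}

theorem lintegral_exp_inner_sub_clip_le [CompleteSpace H] (h : HasBoundedNoise v L p s P)
    {ε l τ : ℝ} {e : H} (hp1 : 1 ≤ p) (hp2 : p ≤ 2) (hs : 0 ≤ s) (hε : 0 < ε) (hl : 0 < l)
    (hLl : (1 + ε) * L ≤ l) (he : ‖e‖ ≤ 1) (hτ : 0 ≤ τ) (hτl : τ * l ≤ 3 / 5) :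
    ∫⁻ ω, ENNReal.ofReal (Real.exp (τ * inner ℝ ((∫ ω', v ω' ∂P) - clip (v ω) l) e)) ∂P
      ≤ ENNReal.ofReal (Real.exp (τ * (aConst p ε s / l ^ (p - 1)))) := by
  obtain ⟨hpow, hpow_le⟩ := h.integrable_rpow (by linarith) hs
  have hcentered : Integrable (fun ω => v ω - ∫ ω', v ω' ∂P) P :=
    h.integrable.sub (integrable_const _)
  have hinner := hcentered.inner_const (𝕜 := ℝ) e
  have hmean : ∫ ω, inner ℝ (v ω - ∫ ω', v ω' ∂P) e ∂P = 0 := by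
    simp only [real_inner_comm e]
    rw [integral_inner hcentered, integral_sub h.integrable (integrable_const _)]
    simp
  set t := l / (1 + 1 / ε) with ht
  have hLt : ‖∫ ω, v ω ∂P‖ + t ≤ l := by
    have hεt : t = l - l / (1 + ε) := by rw [ht]; field_simp; ring
    have hdiv : L ≤ l / (1 + ε) := (le_div_iff₀' (by linarith)).2 hLl
    linarith [h.norm_integral_le]
  have hconst : t ^ (1 - p) * s ^ p = aConst p ε s / l ^ (p - 1) := by
    rw [aConst, ← neg_sub p 1, ht, Real.rpow_neg (by positivity),
      Real.div_rpow hl.le (by positivity), inv_div, mul_div_right_comm]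
  refine lintegral_ofReal_exp_le (((hpow.const_mul (t ^ (1 - p))).sub hinner).const_mul τ)
    (fun ω => exp_mul_inner_sub_clip_le (by positivity) hLt he hp1 hp2 hτ hτl) ?_
  simp only [Pi.sub_apply]
  rw [integral_const_mul, integral_sub (hpow.const_mul _) hinner, hmean, sub_zero,
    integral_const_mul, ← hconst]
  gcongr

theorem lintegral_exp_norm_clip_sq_le (h : HasBoundedNoise v L p s P) {l τ x : ℝ} (hp1 : 1 ≤ p)
    (hp2 : p ≤ 2) (hs : 0 ≤ s) (hl : 0 < l) (hτ : 0 ≤ τ) (hτx : τ * l ^ 2 ≤ x) (hx : x ≤ 1) :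
    ∫⁻ ω, ENNReal.ofReal (Real.exp (τ * ‖clip (v ω) l‖ ^ 2)) ∂P
      ≤ ENNReal.ofReal (Real.exp (τ * ((1 + x) * (bConst p L s * l ^ (2 - p))))) := by
  obtain ⟨hpow, hpow_le⟩ := h.integrable_rpow (by linarith) hs
  have hx0 : 0 ≤ x := le_trans (by positivity) hτx
  have hsum := hpow.add (integrable_const (L ^ p))
  refine lintegral_ofReal_exp_le (k := fun ω => τ * ((1 + x) *
    (2 ^ (p - 1) * (‖v ω - ∫ ω', v ω' ∂P‖ ^ p + L ^ p) * l ^ (2 - p))))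
    ((((hsum.const_mul _).mul_const _).const_mul _).const_mul _) (fun ω => ?_) ?_
  · have hτclip : τ * ‖clip (v ω) l‖ ^ 2 ≤ x := by
      refine le_trans ?_ hτx
      gcongr
      exact norm_clip_le hl
    refine (exp_le_one_add_mul_one_add (by positivity) hτclip (hτclip.trans hx)).trans ?_
    rw [mul_assoc, mul_comm (_ ^ 2)]
    gcongr
    exact norm_clip_sq_le hl h.norm_integral_le hp1 hp2
  · rw [integral_const_mul, integral_const_mul, integral_mul_const, integral_const_mul,
      integral_add hpow (integrable_const _), integral_const, probReal_univ, one_smul, bConst]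
    gcongr

end HasBoundedNoise

end Moments

section Past

variable {Ω E S : Type*} [MeasurableSpace E] [MeasurableSpace S]

/-- The σ-algebra generated by `Y 0, …, Y (n - 1)`. The time-`n` variable `Y n` is excluded, so
that the past is independent of it when the sequence is independent. -/
abbrev past (Y : ℕ → Ω → E) (n : ℕ) : MeasurableSpace Ω :=
  ⨆ i ∈ Set.Iio n, MeasurableSpace.comap (Y i) inferInstance

variable {Y : ℕ → Ω → E}

theorem past_mono : Monotone (past Y) := fun _ _ h =>
  biSup_mono fun _ hi => lt_of_lt_of_le hi h

theorem measurable_past_of_lt {i n : ℕ} (h : i < n) : Measurable[past Y n] (Y i) :=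
  (comap_measurable (Y i)).mono
    (le_biSup (fun j => MeasurableSpace.comap (Y j) inferInstance) (Set.mem_Iio.2 h)) le_rfl

theorem past_le [mΩ : MeasurableSpace Ω] (hY : ∀ n, Measurable (Y n)) (n : ℕ) : past Y n ≤ mΩ :=
  iSup₂_le fun i _ => (hY i).comap_le

variable [MeasurableSpace Ω] {P : Measure Ω}

theorem indepFun_of_measurable_past (hY : ∀ n, Measurable (Y n)) (hind : iIndepFun Y P) {n : ℕ}
    {Z : Ω → S} (hZ : Measurable[past Y n] Z) : IndepFun Z (Y n) P := by
  rw [IndepFun_iff_Indep]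
  have hpast := indep_iSup_of_disjoint (fun i => (hY i).comap_le) hind.iIndep
    (S := Set.Iio n) (T := {n}) (by simp)
  refine indep_of_indep_of_le_left (indep_of_indep_of_le_right hpast ?_) hZ.comap_le
  simp

variable [IsProbabilityMeasure P]

theorem lintegral_prodMk_eq_of_indepFun {Z : Ω → S} {W : Ω → E} (hZ : Measurable Z)
    (hW : Measurable W) (hind : IndepFun Z W P) {F : S × E → ENNReal} (hF : Measurable F) :
    ∫⁻ ω, F (Z ω, W ω) ∂P = ∫⁻ ω, ∫⁻ ω', F (Z ω, W ω') ∂P ∂P := by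
  have hmap := (indepFun_iff_map_prod_eq_prod_map_map hZ.aemeasurable hW.aemeasurable).1 hind
  have : IsProbabilityMeasure (P.map W) := Measure.isProbabilityMeasure_map hW.aemeasurable
  rw [← lintegral_map hF (hZ.prodMk hW), hmap, lintegral_prod _ hF.aemeasurable,
    lintegral_map hF.lintegral_prod_right' hZ]
  exact lintegral_congr fun ω => lintegral_map (hF.comp measurable_prodMk_left) hW

variable {Z : ℕ → Ω → S} (hY : ∀ n, Measurable (Y n)) (hind : iIndepFun Y P)
  (hZ : ∀ n, Measurable[past Y n] (Z n))

include hY hind hZ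

theorem lintegral_prod_le_one_of_measurable_past {g : ℕ → S × E → ENNReal}
    (hg : ∀ n, Measurable (g n)) {N : ℕ}
    (hg1 : ∀ n < N, ∀ z, ∫⁻ ω, g n (z, Y n ω) ∂P ≤ 1) :
    ∫⁻ ω, ∏ n ∈ Finset.range N, g n (Z n ω, Y n ω) ∂P ≤ 1 := by
  induction N with
  | zero => simp
  | succ N ih =>
    set W : Ω → ENNReal := fun ω => ∏ n ∈ Finset.range N, g n (Z n ω, Y n ω) with hW
    have hW_past : Measurable[past Y N] W :=
      Finset.measurable_fun_prod _ fun n hn => (hg n).comp <|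
        ((hZ n).mono (past_mono (Finset.mem_range.1 hn).le) le_rfl).prodMk
          (measurable_past_of_lt (Finset.mem_range.1 hn))
    have hZW : Measurable[past Y N] fun ω => (Z N ω, W ω) := (hZ N).prodMk hW_past
    calc ∫⁻ ω, ∏ n ∈ Finset.range (N + 1), g n (Z n ω, Y n ω) ∂P
        = ∫⁻ ω, W ω * g N (Z N ω, Y N ω) ∂P := by simp only [Finset.prod_range_succ, hW]
      _ = ∫⁻ ω, ∫⁻ ω', W ω * g N (Z N ω, Y N ω') ∂P ∂P :=
          lintegral_prodMk_eq_of_indepFun (hZW.mono (past_le hY N) le_rfl) (hY N)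
            (indepFun_of_measurable_past hY hind hZW)
            (F := fun q => q.1.2 * g N (q.1.1, q.2)) (by fun_prop)
      _ ≤ ∫⁻ ω, W ω ∂P := by
          refine lintegral_mono fun ω => ?_
          have hgY : Measurable fun ω' => g N (Z N ω, Y N ω') :=
            (hg N).comp (measurable_const.prodMk (hY N))
          simp only [lintegral_const_mul _ hgY]
          exact mul_le_of_le_one_right' (hg1 N N.lt_succ_self _)
      _ ≤ 1 := ih fun n hn => hg1 n (hn.trans N.lt_succ_self)

theorem measure_sum_ge_le_exp_neg {h : ℕ → S × E → ℝ} (hh : ∀ n, Measurable (h n)) {θ : ℝ}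
    (hθ : 0 < θ) {c : ℕ → ℝ} {N : ℕ}
    (hmgf : ∀ n < N, ∀ z, ∫⁻ ω, ENNReal.ofReal (Real.exp (θ * h n (z, Y n ω))) ∂P
      ≤ ENNReal.ofReal (Real.exp (θ * c n))) (t : ℝ) :
    P {ω | ∑ n ∈ Finset.range N, c n + t / θ ≤ ∑ n ∈ Finset.range N, h n (Z n ω, Y n ω)}
      ≤ ENNReal.ofReal (Real.exp (-t)) := by
  set g : ℕ → S × E → ENNReal := fun n q =>
    ENNReal.ofReal (Real.exp (-(θ * c n))) * ENNReal.ofReal (Real.exp (θ * h n q)) with hg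
  have hgm : ∀ n, Measurable (g n) := by fun_prop
  have hg1 : ∀ n < N, ∀ z, ∫⁻ ω, g n (z, Y n ω) ∂P ≤ 1 := fun n hn z => by
    simp only [hg]
    rw [lintegral_const_mul' _ _ ENNReal.ofReal_ne_top]
    refine (mul_le_mul_right (hmgf n hn z) _).trans_eq ?_
    rw [← ENNReal.ofReal_mul (Real.exp_pos _).le, ← Real.exp_add, neg_add_cancel, Real.exp_zero,
      ENNReal.ofReal_one]
  have hprod : ∀ ω, ∏ n ∈ Finset.range N, g n (Z n ω, Y n ω) = ENNReal.ofReal (Real.exp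
      (θ * (∑ n ∈ Finset.range N, h n (Z n ω, Y n ω) - ∑ n ∈ Finset.range N, c n))) := fun ω => by
    rw [← Finset.sum_sub_distrib, Finset.mul_sum, Real.exp_sum,
      ENNReal.ofReal_prod_of_nonneg fun i _ => (Real.exp_pos _).le]
    refine Finset.prod_congr rfl fun n _ => ?_
    simp only [hg]
    rw [← ENNReal.ofReal_mul (Real.exp_pos _).le, ← Real.exp_add]
    ring_nf
  have hmarkov := meas_ge_le_lintegral_div (μ := P)
    (f := fun ω => ∏ n ∈ Finset.range N, g n (Z n ω, Y n ω))
    (Finset.measurable_fun_prod _ fun n _ =>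
      (hgm n).comp (((hZ n).mono (past_le hY n) le_rfl).prodMk (hY n))).aemeasurable
    (ε := ENNReal.ofReal (Real.exp t)) (by simpa using Real.exp_pos t) ENNReal.ofReal_ne_top
  refine (measure_mono fun ω hω => ?_).trans (hmarkov.trans ?_)
  · rw [Set.mem_ofPred_eq, ← le_sub_iff_add_le', div_le_iff₀' hθ] at hω
    rw [Set.mem_ofPred_eq, hprod]
    exact ENNReal.ofReal_le_ofReal (Real.exp_le_exp.2 hω)
  · rw [Real.exp_neg, ENNReal.ofReal_inv_of_pos (Real.exp_pos t), ← one_div]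
    exact ENNReal.div_le_div_right
      (lintegral_prod_le_one_of_measurable_past hY hind hZ hgm hg1) _

end Past

theorem bConst_nonneg {p L s : ℝ} (hL : 0 ≤ L) (hs : 0 ≤ s) : 0 ≤ bConst p L s := by
  unfold bConst
  positivity

section TailBounds

variable {H : Type*} [NormedAddCommGroup H] [InnerProductSpace ℝ H] [MeasurableSpace H]
  [BorelSpace H]
  {S E Ω : Type*} [MeasurableSpace S] [MeasurableSpace E] [MeasurableSpace Ω] {P : Measure Ω}
  [IsProbabilityMeasure P] {Y : ℕ → Ω → E} {V : S → E → H} {x : ℕ → Ω → S} {L p s : ℝ}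
  {g l : ℕ → ℝ} {C : ℝ} {N : ℕ}

theorem measurable_integral_comp [SecondCountableTopology H] (hV : Measurable (Function.uncurry V))
    {W : Ω → E} (hW : Measurable W) : Measurable fun z => ∫ ω, V z (W ω) ∂P :=
  (StronglyMeasurable.integral_prod_right (f := fun z ω => V z (W ω))
    (hV.comp (measurable_fst.prodMk (hW.comp measurable_snd))).stronglyMeasurable).measurable

variable (hY : ∀ n, Measurable (Y n)) (hind : iIndepFun Y P) (hx : ∀ n, Measurable[past Y n] (x n))
  (hV : Measurable (Function.uncurry V))
  (hnoise : ∀ n z, HasBoundedNoise (fun ω => V z (Y n ω)) L p s P)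
  (hp1 : 1 ≤ p) (hp2 : p ≤ 2) (hs : 0 ≤ s) (hg : ∀ n, 0 ≤ g n) (hl : ∀ n, 0 < l n)
  (hC : 0 < C) (hgl : ∀ n < N, g n * l n ≤ C)

include hY hind hx hV hnoise hp1 hp2 hs hg hl hC hgl

theorem measure_sum_norm_clip_sq_ge_le (hL : 0 ≤ L) {t : ℝ} (ht : 0 < t) :
    P {ω | (√(bConst p L s * ∑ n ∈ Finset.range N, g n ^ 2 * l n ^ (2 - p)) + C * √t) ^ 2
        ≤ ∑ n ∈ Finset.range N, g n ^ 2 * ‖clip (V (x n ω) (Y n ω)) (l n)‖ ^ 2}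
      ≤ ENNReal.ofReal (Real.exp (-t)) := by
  set B := bConst p L s * ∑ n ∈ Finset.range N, g n ^ 2 * l n ^ (2 - p) with hB
  have hB0 : 0 ≤ B := by
    refine mul_nonneg (bConst_nonneg hL hs) (Finset.sum_nonneg fun n _ => ?_)
    have := hl n
    positivity
  obtain ⟨r, hr0, hr1, hrate⟩ := exists_rate_one_add_mul_add_le hB0 hC ht
  refine (measure_mono fun ω hω => ?_).trans (measure_sum_ge_le_exp_neg hY hind hx
    (h := fun n q => g n ^ 2 * ‖clip (V q.1 q.2) (l n)‖ ^ 2)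
    (fun n => (((continuous_clip (l n)).measurable.comp hV).norm.pow_const 2).const_mul _)
    (θ := r / C ^ 2) (by positivity) (N := N)
    (c := fun n => g n ^ 2 * ((1 + r) * (bConst p L s * l n ^ (2 - p)))) (fun n hn z => ?_) t)
  · rw [Set.mem_ofPred_eq] at hω ⊢
    refine le_trans (hrate.trans' (le_of_eq ?_)) hω
    rw [hB, Finset.mul_sum, Finset.mul_sum]
    congr 1
    exact Finset.sum_congr rfl fun n _ => by ring
  · have hτ : r / C ^ 2 * g n ^ 2 * l n ^ 2 ≤ r := by
      have hsq := pow_le_pow_left₀ (mul_nonneg (hg n) (hl n).le) (hgl n hn) 2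
      rw [mul_assoc, ← mul_pow, div_mul_eq_mul_div, div_le_iff₀ (by positivity)]
      gcongr
    simpa only [mul_assoc] using
      (hnoise n z).lintegral_exp_norm_clip_sq_le hp1 hp2 hs (hl n) (by positivity) hτ hr1

theorem measure_sum_inner_sub_clip_ge_le [CompleteSpace H] [SecondCountableTopology H] {ε : ℝ}
    (hε : 0 < ε) (hLl : ∀ n, (1 + ε) * L ≤ l n) {e : ℕ → Ω → H}
    (he : ∀ n, Measurable[past Y n] (e n)) (he1 : ∀ n ω, ‖e n ω‖ ≤ 1) (t : ℝ) :
    P {ω | aConst p ε s * ∑ n ∈ Finset.range N, g n / l n ^ (p - 1) + 5 / 3 * C * t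
        ≤ ∑ n ∈ Finset.range N, g n *
          inner ℝ ((∫ ω', V (x n ω) (Y n ω') ∂P) - clip (V (x n ω) (Y n ω)) (l n)) (e n ω)}
      ≤ ENNReal.ofReal (Real.exp (-t)) := by
  have hstate : ∀ n, Measurable[past Y n] fun ω =>
      (x n ω, (⟨e n ω, mem_closedBall_zero_iff.2 (he1 n ω)⟩ : Metric.closedBall (0 : H) 1)) :=
    fun n => (hx n).prodMk ((he n).subtype_mk)
  refine (measure_mono fun ω hω => ?_).trans (measure_sum_ge_le_exp_neg hY hind hstate
    (h := fun n q => g n *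
      inner ℝ ((∫ ω', V q.1.1 (Y n ω') ∂P) - clip (V q.1.1 q.2) (l n)) (q.1.2 : H))
    (fun n => ?_) (θ := 3 / (5 * C)) (by positivity) (N := N)
    (c := fun n => g n * (aConst p ε s / l n ^ (p - 1))) (fun n hn z => ?_) t)
  · rw [Set.mem_ofPred_eq] at hω ⊢
    refine le_trans (le_of_eq ?_) hω
    rw [Finset.mul_sum]
    congr 1
    · exact Finset.sum_congr rfl fun n _ => by ring
    · field_simp
  · have hclip : Measurable fun q : (S × Metric.closedBall (0 : H) 1) × E =>
        clip (V q.1.1 q.2) (l n) := (continuous_clip (l n)).measurable.comp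
      (hV.comp ((measurable_fst.comp measurable_fst).prodMk measurable_snd))
    exact ((((measurable_integral_comp hV (hY n)).comp
      (measurable_fst.comp measurable_fst)).sub hclip).inner
      (measurable_subtype_coe.comp (measurable_snd.comp measurable_fst))).const_mul _
  · have hτ : 3 / (5 * C) * g n * l n ≤ 3 / 5 := by
      rw [mul_assoc, div_mul_eq_mul_div, div_le_iff₀ (by positivity)]
      linarith [hgl n hn]
    simpa only [mul_assoc] using (hnoise n z.1).lintegral_exp_inner_sub_clip_le hp1 hp2 hs hε
      (hl n) (hLl n) (mem_closedBall_zero_iff.1 z.2.2)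
      (mul_nonneg (by positivity : 0 ≤ 3 / (5 * C)) (hg n)) hτ

end TailBounds

section Projection

variable {H : Type*} [NormedAddCommGroup H] [InnerProductSpace ℝ H] [CompleteSpace H]
  {X : Set H} (hne : X.Nonempty) (hcl : IsClosed X) (hcv : Convex ℝ X)

include hne hcl hcv

theorem inner_sub_proj_le_zero (x : H) {y : H} (hy : y ∈ X) :
    inner ℝ (x - proj X x) (y - proj X x) ≤ 0 := by
  obtain ⟨hmem, hmin⟩ := proj_spec hne hcl hcv x
  refine (norm_eq_iInf_iff_real_inner_le_zero hcv hmem).1 ?_ y hy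
  have : Nonempty X := hne.to_subtype
  exact le_antisymm (le_ciInf fun w => hmin w w.2)
    (ciInf_le (f := fun w : X => ‖x - w‖) ⟨0, Set.forall_mem_range.2 fun _ => norm_nonneg _⟩
      ⟨proj X x, hmem⟩)

theorem norm_proj_sub_proj_le (x y : H) : ‖proj X x - proj X y‖ ≤ ‖x - y‖ := by
  have hx := inner_sub_proj_le_zero hne hcl hcv x (proj_spec hne hcl hcv y).1
  have hy := inner_sub_proj_le_zero hne hcl hcv y (proj_spec hne hcl hcv x).1
  have hinner : inner ℝ (x - y) (proj X x - proj X y) = ‖proj X x - proj X y‖ ^ 2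
      - inner ℝ (x - proj X x) (proj X y - proj X x)
      - inner ℝ (y - proj X y) (proj X x - proj X y) := by
    rw [← real_inner_self_eq_norm_sq]
    simp only [inner_sub_left, inner_sub_right]
    ring
  have hcs := real_inner_le_norm (x - y) (proj X x - proj X y)
  by_contra! hlt
  nlinarith [norm_nonneg (x - y)]

theorem continuous_proj : Continuous (proj X) :=
  LipschitzWith.continuous (K := 1) (LipschitzWith.of_dist_le_mul fun x y => by
    simpa [dist_eq_norm] using norm_proj_sub_proj_le hne hcl hcv x y)

theorem proj_eq_self {y : H} (hy : y ∈ X) : proj X y = y := by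
  have hmin := (proj_spec hne hcl hcv y).2 y hy
  rw [sub_self, norm_zero] at hmin
  exact (sub_eq_zero.1 (norm_le_zero_iff.1 hmin)).symm

theorem norm_proj_sub_le (x : H) {y : H} (hy : y ∈ X) : ‖proj X x - y‖ ≤ ‖x - y‖ := by
  simpa only [proj_eq_self hne hcl hcv hy] using norm_proj_sub_proj_le hne hcl hcv x y

end Projection

section Subgradient

variable {H : Type*} [NormedAddCommGroup H] [InnerProductSpace ℝ H] {f : H → ℝ} {X : Set H}

/-- `u` is a subgradient at `x` of the restriction of `f` to `X`: the subgradient inequality is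
only required against points of `X`. -/
def IsSubgradientWithin (f : H → ℝ) (X : Set H) (x u : H) : Prop :=
  ∀ y ∈ X, f x + inner ℝ u (y - x) ≤ f y

theorem norm_le_of_mem_subdifferential {K : NNReal} (hf : LipschitzWith K f) {x u : H}
    (hu : u ∈ subdifferential f x) : ‖u‖ ≤ K := by
  have hsub := hu (x + u)
  have hlip := hf.dist_le_mul (x + u) x
  rw [add_sub_cancel_left, real_inner_self_eq_norm_mul_norm] at hsub
  rw [dist_eq_norm, dist_eq_norm, add_sub_cancel_left, Real.norm_eq_abs] at hlip
  by_contra! hlt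
  nlinarith [le_abs_self (f (x + u) - f x), hlt.trans_le' K.2, norm_nonneg u]

theorem convexOn_of_forall_exists_isSubgradientWithin (hX : Convex ℝ X)
    (hu : ∀ x ∈ X, ∃ u, IsSubgradientWithin f X x u) : ConvexOn ℝ X f := by
  refine ⟨hX, fun x hx y hy a b ha hb hab => ?_⟩
  obtain ⟨u, hu⟩ := hu _ (hX hx hy ha hb hab)
  have hcancel : a * inner ℝ u (x - (a • x + b • y)) + b * inner ℝ u (y - (a • x + b • y)) = 0 := by
    simp only [inner_sub_right, inner_add_right, inner_smul_right]
    linear_combination (-a * inner ℝ u x - b * inner ℝ u y) * hab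
  have hfx := mul_le_mul_of_nonneg_left (hu x hx) ha
  have hfy := mul_le_mul_of_nonneg_left (hu y hy) hb
  simp only [smul_eq_mul]
  linear_combination hfx + hfy - hcancel - f (a • x + b • y) * hab

theorem mul_map_average_sub_le_sum (hf : ConvexOn ℝ X f) {x : ℕ → H} {γ : ℕ → ℝ} {k : ℕ}
    (hk : 1 ≤ k) (hx : ∀ i ∈ Finset.Icc 1 k, x i ∈ X) (hγ0 : 0 ≤ γ k)
    (hγ : AntitoneOn γ (Set.Ici 1)) {c : ℝ} (hc : ∀ i ∈ Finset.Icc 1 k, c ≤ f (x i)) :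
    k * γ k * (f ((1 / (k : ℝ)) • ∑ i ∈ Finset.Icc 1 k, x i) - c)
      ≤ ∑ i ∈ Finset.Icc 1 k, γ i * (f (x i) - c) := by
  have hk0 : (0 : ℝ) < k := by exact_mod_cast hk
  have hjensen := hf.map_sum_le (t := Finset.Icc 1 k) (w := fun _ => 1 / (k : ℝ)) (p := x)
    (fun i _ => by positivity)
    (by simp [hk0.ne']) hx
  rw [← Finset.smul_sum, ← Finset.smul_sum, smul_eq_mul, one_div_mul_eq_div,
    le_div_iff₀' hk0] at hjensen
  calc k * γ k * (f ((1 / (k : ℝ)) • ∑ i ∈ Finset.Icc 1 k, x i) - c)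
      = γ k * (k * f ((1 / (k : ℝ)) • ∑ i ∈ Finset.Icc 1 k, x i) - k * c) := by ring
    _ ≤ γ k * (∑ i ∈ Finset.Icc 1 k, f (x i) - k * c) := by gcongr
    _ = ∑ i ∈ Finset.Icc 1 k, γ k * (f (x i) - c) := by
        simp [← Finset.mul_sum, Finset.sum_sub_distrib]
    _ ≤ ∑ i ∈ Finset.Icc 1 k, γ i * (f (x i) - c) := Finset.sum_le_sum fun i hi =>
        mul_le_mul_of_nonneg_right
          (hγ (Finset.mem_Icc.1 hi).1 hk (Finset.mem_Icc.1 hi).2) (sub_nonneg.2 (hc i hi))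

theorem sum_Icc_one_eq_sum_range (a : ℕ → ℝ) (k : ℕ) :
    ∑ i ∈ Finset.Icc 1 k, a i = ∑ n ∈ Finset.range k, a (n + 1) := by
  rw [← Finset.Ico_add_one_right_eq_Icc, Finset.sum_Ico_eq_sum_range, Nat.add_sub_cancel]
  simp only [add_comm]

theorem map_average_sub_le_of_sqrt_sum_le (hf : ConvexOn ℝ X f) {x : ℕ → H} {γ : ℕ → ℝ} {k : ℕ}
    (hk : 1 ≤ k) (hx : ∀ i ∈ Finset.Icc 1 k, x i ∈ X) (hγ0 : 0 < γ k)
    (hγ : AntitoneOn γ (Set.Ici 1)) {c : ℝ} (hc : ∀ i ∈ Finset.Icc 1 k, c ≤ f (x i)) {R : ℝ}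
    (hR : √(∑ n ∈ Finset.range k, 2 * γ (n + 1) * (f (x (n + 1)) - c)) ≤ R) :
    f ((1 / (k : ℝ)) • ∑ i ∈ Finset.Icc 1 k, x i) - c ≤ 1 / (2 * k * γ k) * R ^ 2 := by
  have : (0 : ℝ) < k := by exact_mod_cast hk
  have hsum := (Real.sqrt_le_left ((Real.sqrt_nonneg _).trans hR)).1 hR
  rw [← sum_Icc_one_eq_sum_range fun i => 2 * γ i * (f (x i) - c)] at hsum
  simp only [mul_assoc, ← Finset.mul_sum] at hsum
  rw [one_div_mul_eq_div, le_div_iff₀ (by positivity)]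
  linarith [mul_map_average_sub_le_sum hf hk hx hγ0.le hγ hc]

theorem norm_proj_step_sq_add_le [CompleteSpace H] (hcl : IsClosed X) (hcv : Convex ℝ X)
    {x y u v : H} (hy : y ∈ X) (hu : IsSubgradientWithin f X x u) {γ : ℝ} (hγ : 0 ≤ γ) :
    ‖proj X (x - γ • v) - y‖ ^ 2 + 2 * γ * (f x - f y)
      ≤ ‖x - y‖ ^ 2 + 2 * γ * inner ℝ (u - v) (x - y) + γ ^ 2 * ‖v‖ ^ 2 := by
  have hproj := pow_le_pow_left₀ (norm_nonneg _)
    (norm_proj_sub_le ⟨y, hy⟩ hcl hcv (x - γ • v) hy) 2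
  have hexpand : ‖x - γ • v - y‖ ^ 2
      = ‖x - y‖ ^ 2 - 2 * γ * inner ℝ v (x - y) + γ ^ 2 * ‖v‖ ^ 2 := by
    rw [sub_right_comm, norm_sub_sq_real, real_inner_smul_right, norm_smul, mul_pow,
      Real.norm_eq_abs, sq_abs, real_inner_comm]
    ring
  have hsub : f x - f y ≤ inner ℝ u (x - y) := by
    have := hu y hy
    rw [← neg_sub x y, inner_neg_right] at this
    linarith
  rw [inner_sub_left]
  linarith [mul_le_mul_of_nonneg_left hsub (by linarith : 0 ≤ 2 * γ)]

end Subgradient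

section Potential

variable {H : Type*} [NormedAddCommGroup H] [InnerProductSpace ℝ H] {γ : ℕ → ℝ} {x w : ℕ → H}
  {y : H} {K : ℝ}

/-- The upper bound for `‖x n - y‖ ^ 2` that results from summing the one-step inequalities of the
method, when `w i` is the error of the `i`-th subgradient and `K` bounds the sum of the squared
lengths of the steps. Unlike `‖x n - y‖ ^ 2`, its increments are linear in the errors. -/
def potential (γ : ℕ → ℝ) (x w : ℕ → H) (y : H) (K : ℝ) (n : ℕ) : ℝ :=
  ‖x 0 - y‖ ^ 2 + K + ∑ i ∈ Finset.range n, 2 * γ i * inner ℝ (w i) (x i - y)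

/-- The vector `x n - y` divided by the root of the potential. The maximum makes it of norm at most
one on every sample path, and is equal to the root where the potential dominates
`‖x n - y‖ ^ 2`. -/
noncomputable def direction (γ : ℕ → ℝ) (x w : ℕ → H) (y : H) (K : ℝ) (n : ℕ) : H :=
  (max √(potential γ x w y K n) ‖x n - y‖)⁻¹ • (x n - y)

theorem norm_direction_le_one (n : ℕ) : ‖direction γ x w y K n‖ ≤ 1 := by
  have hmax : 0 ≤ max √(potential γ x w y K n) ‖x n - y‖ := le_max_of_le_right (norm_nonneg _)
  rw [direction, norm_smul, norm_inv, Real.norm_of_nonneg hmax, inv_mul_eq_div]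
  exact div_le_one_of_le₀ (le_max_right _ _) hmax

theorem measurable_direction [MeasurableSpace H] [BorelSpace H] [SecondCountableTopology H]
    {Ω : Type*} [mΩ : MeasurableSpace Ω] {x w : ℕ → Ω → H} {n : ℕ} (hx : ∀ i ≤ n, Measurable (x i))
    (hw : ∀ i < n, Measurable (w i)) :
    Measurable fun ω => direction γ (fun i => x i ω) (fun i => w i ω) y K n := by
  have hsub : ∀ i ≤ n, Measurable fun ω => x i ω - y := fun i hi => (hx i hi).sub_const y
  have hpotential : Measurable fun ω => potential γ (fun i => x i ω) (fun i => w i ω) y K n :=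
    (((hsub 0 n.zero_le).norm.pow_const 2).add_const K).add <|
      Finset.measurable_fun_sum _ fun i hi =>
        ((hw i (Finset.mem_range.1 hi)).inner (hsub i (Finset.mem_range.1 hi).le)).const_mul _
  exact (hpotential.sqrt.max (hsub n le_rfl).norm).inv.smul (hsub n le_rfl)

variable {φ q : ℕ → ℝ} {N : ℕ}
  (hrec : ∀ n < N, ‖x (n + 1) - y‖ ^ 2 + φ n
    ≤ ‖x n - y‖ ^ 2 + 2 * γ n * inner ℝ (w n) (x n - y) + q n)
  (hq : ∀ n, 0 ≤ q n) (hqK : ∑ n ∈ Finset.range N, q n ≤ K)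

include hrec hq hqK

theorem norm_sub_sq_add_sum_le_potential {n : ℕ} (hn : n ≤ N) :
    ‖x n - y‖ ^ 2 + ∑ i ∈ Finset.range n, φ i ≤ potential γ x w y K n := by
  have htel := Finset.sum_le_sum fun i (hi : i ∈ Finset.range n) =>
    sub_le_sub_right (hrec i ((Finset.mem_range.1 hi).trans_le hn)) (‖x i - y‖ ^ 2 + φ i)
  have hsplit : ∀ i, ‖x (i + 1) - y‖ ^ 2 + φ i - (‖x i - y‖ ^ 2 + φ i)
      = ‖x (i + 1) - y‖ ^ 2 - ‖x i - y‖ ^ 2 := fun i => by ring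
  have hsplit' : ∀ i, ‖x i - y‖ ^ 2 + 2 * γ i * inner ℝ (w i) (x i - y) + q i
      - (‖x i - y‖ ^ 2 + φ i) = 2 * γ i * inner ℝ (w i) (x i - y) + q i - φ i := fun i => by ring
  simp only [hsplit, hsplit', Finset.sum_range_sub fun i => ‖x i - y‖ ^ 2,
    Finset.sum_add_distrib, Finset.sum_sub_distrib] at htel
  have hqn : ∑ i ∈ Finset.range n, q i ≤ K :=
    (Finset.sum_le_sum_of_subset_of_nonneg (Finset.range_mono hn) fun i _ _ => hq i).trans hqK
  rw [potential]
  linarith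

theorem sqrt_sum_le_add_sum_inner_direction (hφ : ∀ n, 0 ≤ φ n) :
    √(∑ n ∈ Finset.range N, φ n) ≤ ‖x 0 - y‖ + √K
      + ∑ n ∈ Finset.range N, γ n * inner ℝ (w n) (direction γ x w y K n) := by
  have hU := fun n (hn : n ≤ N) => norm_sub_sq_add_sum_le_potential hrec hq hqK hn
  have hφsum : ∀ n, 0 ≤ ∑ i ∈ Finset.range n, φ i := fun n => Finset.sum_nonneg fun i _ => hφ i
  have hdU : ∀ n ≤ N, ‖x n - y‖ ^ 2 ≤ potential γ x w y K n := fun n hn =>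
    (le_add_of_nonneg_right (hφsum n)).trans (hU n hn)
  have htangent := sqrt_add_sum_le (N := N) (a := ‖x 0 - y‖ ^ 2 + K)
    (b := fun n => 2 * γ n * inner ℝ (w n) (x n - y))
    (fun n hn => (sq_nonneg _).trans (hdU n hn)) (fun n hn hzero => by
      have hx : x n - y = 0 := by
        simpa using ((hdU n hn.le).trans_eq hzero).antisymm (sq_nonneg _)
      rw [hx, inner_zero_right, mul_zero])
  have hterm : ∀ n ∈ Finset.range N, 2 * γ n * inner ℝ (w n) (x n - y)
      / (2 * √(potential γ x w y K n)) = γ n * inner ℝ (w n) (direction γ x w y K n) :=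
    fun n hn => by
      rw [direction, max_eq_left (Real.le_sqrt_of_sq_le (hdU n (Finset.mem_range.1 hn).le)),
        real_inner_smul_right, mul_assoc, mul_div_mul_left _ _ two_ne_zero, div_eq_inv_mul]
      ring
  have hK : 0 ≤ K := (Finset.sum_nonneg fun n _ => hq n).trans hqK
  have hroot : √(‖x 0 - y‖ ^ 2 + K) ≤ ‖x 0 - y‖ + √K := by
    rw [Real.sqrt_le_left (by positivity), add_sq, Real.sq_sqrt hK]
    linarith [mul_nonneg (norm_nonneg (x 0 - y)) (Real.sqrt_nonneg K)]
  calc √(∑ n ∈ Finset.range N, φ n) ≤ √(potential γ x w y K N) :=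
        Real.sqrt_le_sqrt ((le_add_of_nonneg_left (sq_nonneg _)).trans (hU N le_rfl))
    _ ≤ √(‖x 0 - y‖ ^ 2 + K) + ∑ n ∈ Finset.range N,
          2 * γ n * inner ℝ (w n) (x n - y) / (2 * √(potential γ x w y K n)) := htangent
    _ ≤ _ := by
        rw [Finset.sum_congr rfl hterm]
        gcongr

end Potential

section Regret

variable {H : Type*} [NormedAddCommGroup H] [InnerProductSpace ℝ H] [CompleteSpace H]
  [SecondCountableTopology H] [MeasurableSpace H] [BorelSpace H] {E Ω : Type*} [MeasurableSpace E]
  [MeasurableSpace Ω] {P : Measure Ω} [IsProbabilityMeasure P]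

theorem ofReal_one_sub_add_le_measure {s t u : Set Ω} {a b : ℝ} (ha : 0 ≤ a) (hb : 0 ≤ b)
    (hs : P s ≤ ENNReal.ofReal a) (ht : P t ≤ ENNReal.ofReal b)
    (hu : ∀ ω, ω ∉ s → ω ∉ t → ω ∈ u) : ENNReal.ofReal (1 - (a + b)) ≤ P u := by
  have hcover : Set.univ ⊆ u ∪ (s ∪ t) := fun ω _ => by
    by_contra hω
    simp only [Set.mem_union, not_or] at hω
    exact hω.1 (hu ω hω.2.1 hω.2.2)
  rw [ENNReal.ofReal_sub _ (add_nonneg ha hb), ENNReal.ofReal_one, tsub_le_iff_right,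
    ENNReal.ofReal_add ha hb, ← measure_univ (μ := P)]
  calc P Set.univ ≤ P (u ∪ (s ∪ t)) := measure_mono hcover
    _ ≤ P u + (P s + P t) := (measure_union_le _ _).trans (by gcongr; exact measure_union_le _ _)
    _ ≤ P u + (ENNReal.ofReal a + ENNReal.ofReal b) := by gcongr

theorem ofReal_one_sub_le_measure_sqrt_sum_le {f : H → ℝ} {X : Set H} (hcl : IsClosed X)
    (hcv : Convex ℝ X) {Y : ℕ → Ω → E} {V : X → E → H} {x : ℕ → Ω → X} {L p s ε C : ℝ}
    {g l : ℕ → ℝ} {N : ℕ} (hY : ∀ n, Measurable (Y n)) (hind : iIndepFun Y P)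
    (hx : ∀ n, Measurable[past Y n] (x n)) (hV : Measurable (Function.uncurry V))
    (hstep : ∀ n ω, (x (n + 1) ω : H) = proj X (x n ω - g n • clip (V (x n ω) (Y n ω)) (l n)))
    (hnoise : ∀ n z, HasBoundedNoise (fun ω => V z (Y n ω)) L p s P)
    (hsub : ∀ n (z : X), IsSubgradientWithin f X z (∫ ω, V z (Y n ω) ∂P))
    (hp1 : 1 ≤ p) (hp2 : p ≤ 2) (hs : 0 ≤ s) (hg : ∀ n, 0 ≤ g n) (hL : 0 < L) (hε : 0 < ε)
    (hLl : ∀ n, (1 + ε) * L ≤ l n) (hC : 0 < C) (hgl : ∀ n < N, g n * l n ≤ C) {y : H}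
    (hy : y ∈ X) (hymin : ∀ z ∈ X, f y ≤ f z) {t : ℝ} (ht : 0 < t) :
    ENNReal.ofReal (1 - (Real.exp (-t) + Real.exp (-t))) ≤
      P {ω | √(∑ n ∈ Finset.range N, 2 * g n * (f (x n ω) - f y)) ≤ ‖(x 0 ω : H) - y‖
        + aConst p ε s * ∑ n ∈ Finset.range N, g n / l n ^ (p - 1)
        + √(bConst p L s * ∑ n ∈ Finset.range N, g n ^ 2 * l n ^ (2 - p))
        + C * (5 / 3 * t + √t)} := by
  set B := bConst p L s * ∑ n ∈ Finset.range N, g n ^ 2 * l n ^ (2 - p)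
  set v : ℕ → Ω → H := fun n ω => clip (V (x n ω) (Y n ω)) (l n)
  set w : ℕ → Ω → H := fun n ω => (∫ ω', V (x n ω) (Y n ω') ∂P) - v n ω
  set e : ℕ → Ω → H := fun n ω =>
    direction g (fun i => x i ω) (fun i => w i ω) y ((√B + C * √t) ^ 2) n
  have hl : ∀ n, 0 < l n := fun n => (by positivity : 0 < (1 + ε) * L).trans_le (hLl n)
  have hx_past : ∀ {i n}, i ≤ n → Measurable[past Y n] (x i) := fun h =>
    (hx _).mono (past_mono h) le_rfl
  have hw_past : ∀ {i n}, i < n → Measurable[past Y n] (w i) := fun {i n} h =>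
    ((measurable_integral_comp hV (hY i)).comp (hx_past h.le)).sub
      ((continuous_clip (l i)).measurable.comp
        (hV.comp ((hx_past h.le).prodMk (measurable_past_of_lt h))))
  have he_past : ∀ n, Measurable[past Y n] (e n) := fun n =>
    measurable_direction (mΩ := past Y n) (x := fun i ω => (x i ω : H))
      (fun i hi => measurable_subtype_coe.comp (hx_past hi)) fun i hi => hw_past hi
  refine ofReal_one_sub_add_le_measure (Real.exp_pos _).le (Real.exp_pos _).le
    (measure_sum_norm_clip_sq_ge_le hY hind hx hV hnoise hp1 hp2 hs hg hl hC hgl hL.le ht)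
    (measure_sum_inner_sub_clip_ge_le hY hind hx hV hnoise hp1 hp2 hs hg hl hC hgl hε hLl
      he_past (fun n ω => norm_direction_le_one n) t) fun ω hω_sq hω_inner => ?_
  rw [Set.mem_ofPred_eq, not_le] at hω_sq hω_inner
  have hroot := sqrt_sum_le_add_sum_inner_direction (γ := g) (x := fun n => (x n ω : H))
    (w := fun n => w n ω) (y := y) (N := N) (φ := fun n => 2 * g n * (f (x n ω) - f y))
    (q := fun n => g n ^ 2 * ‖v n ω‖ ^ 2)
    (fun n _ => by
      rw [hstep]
      exact norm_proj_step_sq_add_le hcl hcv hy (hsub n (x n ω)) (hg n))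
    (fun n => by positivity) hω_sq.le
    (fun n => mul_nonneg (mul_nonneg zero_le_two (hg n)) (sub_nonneg.2 (hymin _ (x n ω).2)))
  rw [Real.sqrt_sq (by positivity)] at hroot
  rw [Set.mem_ofPred_eq]
  linarith

end Regret

section Constants

variable {γ lam : ℕ → ℝ}

theorem mul_le_seqC {k i : ℕ} (hk : 1 ≤ k) (hi : i ∈ Finset.Icc 1 k) :
    γ i * lam i ≤ seqC γ lam k hk :=
  Finset.le_sup' (fun i => γ i * lam i) hi

theorem seqA_nonneg {p ε s : ℝ} (hε : 0 ≤ ε) (hs : 0 ≤ s) (hγ : ∀ i, 1 ≤ i → 0 ≤ γ i)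
    (hlam : ∀ i, 1 ≤ i → 0 ≤ lam i) (k : ℕ) : 0 ≤ seqA p ε s γ lam k :=
  mul_nonneg (by unfold aConst; positivity) <| Finset.sum_nonneg fun i hi =>
    div_nonneg (hγ i (Finset.mem_Icc.1 hi).1)
      (Real.rpow_nonneg (hlam i (Finset.mem_Icc.1 hi).1) _)

theorem seqB_nonneg {p L s : ℝ} (hL : 0 ≤ L) (hs : 0 ≤ s) (hlam : ∀ i, 1 ≤ i → 0 ≤ lam i) (k : ℕ) :
    0 ≤ seqB p L s γ lam k :=
  mul_nonneg (bConst_nonneg hL hs) <| Finset.sum_nonneg fun i hi =>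
    mul_nonneg (sq_nonneg _) (Real.rpow_nonneg (hlam i (Finset.mem_Icc.1 hi).1) _)

theorem seqC_pos (hγ : ∀ i, 1 ≤ i → 0 < γ i) (hlam : ∀ i, 1 ≤ i → 0 < lam i) {k : ℕ}
    (hk : 1 ≤ k) : 0 < seqC γ lam k hk :=
  (mul_pos (hγ 1 le_rfl) (hlam 1 le_rfl)).trans_le
    (mul_le_seqC hk (Finset.mem_Icc.2 ⟨le_rfl, hk⟩))

theorem seqD_nonneg {k : ℕ} (hk : 1 ≤ k) : 0 ≤ seqD γ lam k hk :=
  (mul_nonneg (sq_nonneg (γ 1)) (sq_nonneg (lam 1))).trans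
    (Finset.le_sup' (fun i => γ i ^ 2 * lam i ^ 2) (Finset.mem_Icc.2 ⟨le_rfl, hk⟩))

theorem one_le_log_two_div {δ : ℝ} (hδ0 : 0 < δ) (hδ : δ ≤ 2 / Real.exp 1) :
    1 ≤ Real.log (2 / δ) :=
  (Real.le_log_iff_exp_le (by positivity)).2 ((le_div_comm₀ hδ0 (Real.exp_pos 1)).1 hδ)

theorem sq_radius_le {p ε L s r t : ℝ} (hε : 0 ≤ ε) (hL : 0 ≤ L) (hs : 0 ≤ s)
    (hγ : ∀ i, 1 ≤ i → 0 < γ i) (hlam : ∀ i, 1 ≤ i → 0 < lam i) {k : ℕ} (hk : 1 ≤ k) (hr : 0 ≤ r)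
    (ht : 1 ≤ t) :
    (r + seqA p ε s γ lam k + √(seqB p L s γ lam k) + seqC γ lam k hk * (5 / 3 * t + √t)) ^ 2 ≤
      (r + seqA p ε s γ lam k + seqB p L s γ lam k
        + 8 / 3 * (seqC γ lam k hk + seqD γ lam k hk) * t
        + (√(seqB p L s γ lam k) + √(seqE p L s γ lam k)) * √t) ^ 2 := by
  have hA : 0 ≤ seqA p ε s γ lam k :=
    seqA_nonneg hε hs (fun i hi => (hγ i hi).le) (fun i hi => (hlam i hi).le) k
  have hB : 0 ≤ seqB p L s γ lam k := seqB_nonneg hL hs (fun i hi => (hlam i hi).le) k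
  have hC : 0 ≤ seqC γ lam k hk := (seqC_pos hγ hlam hk).le
  exact pow_le_pow_left₀ (by positivity) (add_mul_add_sqrt_le hB hC (seqD_nonneg hk) ht) 2

end Constants

section Iterates

variable {H Ξ Ω : Type*} [NormedAddCommGroup H] {X : Set H} {m : ℕ}
  {uhat : H → Ξ → H} {γ lam : ℕ → ℝ} {x₁ : H} {ξs : ℕ → Fin m → Ω → Ξ}

theorem measurable_batchMean [NormedSpace ℝ H] [MeasurableSpace H] [BorelSpace H]
    [SecondCountableTopology H] [MeasurableSpace Ξ]
    (huhat : Measurable fun z : X × Ξ => uhat z.1 z.2) :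
    Measurable (Function.uncurry fun (x : X) (z : Fin m → Ξ) => batchMean uhat x z) :=
  (Finset.measurable_fun_sum _ fun j _ => huhat.comp
    (measurable_fst.prodMk ((measurable_pi_apply j).comp measurable_snd))).const_smul _

variable [InnerProductSpace ℝ H] [CompleteSpace H] (hcl : IsClosed X) (hcv : Convex ℝ X)
  (hx₁ : x₁ ∈ X)

include hcl hcv hx₁

theorem iterate_mem (k : ℕ) (ω : Ω) : iterate X uhat γ lam x₁ ξs k ω ∈ X := by
  match k with
  | 0 | 1 => exact hx₁
  | k + 2 => exact (proj_spec ⟨x₁, hx₁⟩ hcl hcv _).1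

theorem measurable_past_iterate [MeasurableSpace H] [BorelSpace H] [SecondCountableTopology H]
    [MeasurableSpace Ξ] (huhat : Measurable fun z : X × Ξ => uhat z.1 z.2) (n : ℕ) :
    Measurable[past (fun n ω j => ξs (n + 1) j ω) n] fun ω =>
      (⟨iterate X uhat γ lam x₁ ξs (n + 1) ω, iterate_mem hcl hcv hx₁ (n + 1) ω⟩ : X) := by
  induction n with
  | zero => exact @measurable_const X Ω _ (past _ 0) ⟨x₁, hx₁⟩
  | succ n ih =>
    have hiterate := ih.mono (past_mono (Y := fun n ω j => ξs (n + 1) j ω) n.le_succ) le_rfl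
    have hclip := (continuous_clip (lam (n + 1))).measurable.comp <|
      (measurable_batchMean huhat).comp <|
        hiterate.prodMk (measurable_past_of_lt n.lt_succ_self)
    exact ((continuous_proj ⟨x₁, hx₁⟩ hcl hcv).measurable.comp
      ((measurable_subtype_coe.comp hiterate).sub (hclip.const_smul (γ (n + 1))))).subtype_mk

end Iterates

section Batch

variable {H Ξ Ω : Type*} [NormedAddCommGroup H] [MeasurableSpace H] [BorelSpace H]
  [MeasurableSpace Ω] {P : Measure Ω} {m : ℕ}

section Average

variable [NormedSpace ℝ H] {v : Fin m → Ω → H} {v₀ : Ω → H}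
  (hv : ∀ j, IdentDistrib (v j) v₀ P P) (hint : Integrable v₀ P)

include hv hint

theorem integrable_average : Integrable (fun ω => (1 / (m : ℝ)) • ∑ j, v j ω) P :=
  (integrable_finsetSum _ fun j _ => (hv j).integrable_iff.2 hint).smul _

theorem integral_average (hm : 1 ≤ m) :
    ∫ ω, (1 / (m : ℝ)) • ∑ j, v j ω ∂P = ∫ ω, v₀ ω ∂P := by
  have hm0 : (m : ℝ) ≠ 0 := by exact_mod_cast (by lia : m ≠ 0)
  rw [integral_smul, integral_finsetSum _ fun j _ => (hv j).integrable_iff.2 hint,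
    Finset.sum_congr rfl fun j _ => (hv j).integral_eq, Finset.sum_const, Finset.card_univ,
    Fintype.card_fin, ← Nat.cast_smul_eq_nsmul ℝ, smul_smul, one_div_mul_cancel hm0, one_smul]

end Average

theorem map_eq_pi_of_identDistrib [MeasurableSpace Ξ] [IsProbabilityMeasure P] {ι : Type*}
    [Fintype ι] {ξs : ι → Ω → Ξ} {ξ : Ω → Ξ} (hcopy : ∀ j, IdentDistrib (ξs j) ξ P P)
    (hind : iIndepFun ξs P) :
    P.map (fun ω j => ξs j ω) = Measure.pi fun _ => P.map ξ := by
  rw [hind.map_fun_eq_pi_map fun j => (hcopy j).aemeasurable_fst]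
  simp only [fun j => (hcopy j).map_eq]

variable [NormedSpace ℝ H] [MeasurableSpace Ξ] {uhat : H → Ξ → H} {x : H} {ξ : Ω → Ξ}
  {ξs : Fin m → Ω → Ξ}
  (huhat : Measurable (uhat x)) (hint : Integrable (fun ω => uhat x (ξ ω)) P)
  (hcopy : ∀ j, IdentDistrib (ξs j) ξ P P)

include huhat hint hcopy

theorem integral_batchMean (hm : 1 ≤ m) :
    ∫ ω, batchMean uhat x (fun j => ξs j ω) ∂P = ∫ ω, uhat x (ξ ω) ∂P :=
  integral_average (fun j => (hcopy j).comp huhat) hint hm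

theorem hasBoundedNoise_batchMean [SecondCountableTopology H] [IsProbabilityMeasure P] (hm : 1 ≤ m)
    (hind : iIndepFun ξs P) {L p s : ℝ}
    (hL : ‖∫ ω, uhat x (ξ ω) ∂P‖ ≤ L)
    (hmoment : ∫⁻ z, ‖batchMean uhat x z -
        ∫ z', batchMean uhat x z' ∂(Measure.pi fun _ : Fin m => P.map ξ)‖ₑ ^ p
      ∂(Measure.pi fun _ : Fin m => P.map ξ) ≤ ENNReal.ofReal (s ^ p)) :
    HasBoundedNoise (fun ω => batchMean uhat x (fun j => ξs j ω)) L p s P := by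
  have hbatch : AEMeasurable (fun ω j => ξs j ω) P :=
    aemeasurable_pi_iff.2 fun j => (hcopy j).aemeasurable_fst
  have hmean : Measurable fun z : Fin m → Ξ => batchMean uhat x z :=
    (Finset.measurable_fun_sum _ fun j _ => huhat.comp (measurable_pi_apply j)).const_smul _
  refine ⟨integrable_average (fun j => (hcopy j).comp huhat) hint,
    (integral_batchMean huhat hint hcopy hm).symm ▸ hL, ?_⟩
  rwa [← map_eq_pi_of_identDistrib hcopy hind,
    integral_map hbatch hmean.aestronglyMeasurable,
    lintegral_map' ((hmean.sub_const _).enorm.pow_const p).aemeasurable hbatch] at hmoment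

end Batch

end CSSGM

open CSSGM

theorem mainTheorem5_general
    {H : Type*} [NormedAddCommGroup H] [InnerProductSpace ℝ H] [CompleteSpace H]
    [SecondCountableTopology H] [MeasurableSpace H] [BorelSpace H]
    {Ξ : Type*} [MeasurableSpace Ξ] {Ω : Type*} [MeasurableSpace Ω] {P : Measure Ω}
    [IsProbabilityMeasure P] {f : H → ℝ} {X : Set H} (hcl : IsClosed X) (hcv : Convex ℝ X)
    {uhat : H → Ξ → H} (huhat : Measurable fun z : X × Ξ => uhat z.1 z.2) {m : ℕ}
    {ξs : ℕ → Fin m → Ω → Ξ} (hmeas : ∀ k, 1 ≤ k → ∀ j, Measurable (ξs k j))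
    (hind : iIndepFun (fun (k : Set.Ici (1 : ℕ)) (ω : Ω) (j : Fin m) => ξs k j ω) P)
    {L p s : ℝ} (hL : 0 < L) (hp1 : 1 ≤ p) (hp2 : p ≤ 2) (hs : 0 ≤ s)
    (hnoise : ∀ k, 1 ≤ k → ∀ x ∈ X,
      HasBoundedNoise (fun ω => batchMean uhat x fun j => ξs k j ω) L p s P)
    (hsub : ∀ k, 1 ≤ k → ∀ x ∈ X,
      IsSubgradientWithin f X x (∫ ω, batchMean uhat x (fun j => ξs k j ω) ∂P))
    {γ lam : ℕ → ℝ} (hγ : ∀ k, 1 ≤ k → 0 < γ k) (hγ_anti : AntitoneOn γ (Set.Ici 1)) {ε : ℝ}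
    (hε : 0 < ε) (hlam : ∀ k, 1 ≤ k → (1 + ε) * L ≤ lam k) {x₁ y : H} (hx₁ : x₁ ∈ X)
    (hy : y ∈ X) (hymin : ∀ z ∈ X, f y ≤ f z) {δ : ℝ} (hδ0 : 0 < δ) (hδ2 : δ < 2)
    {k : ℕ} (hk : 1 ≤ k) :
    ENNReal.ofReal (1 - δ) ≤
      P {ω | f (avgIterate X uhat γ lam x₁ ξs k ω) - f y ≤
        1 / (2 * k * γ k) *
          (‖x₁ - y‖ + seqA p ε s γ lam k + √(seqB p L s γ lam k)
            + seqC γ lam k hk * (5 / 3 * Real.log (2 / δ) + √(Real.log (2 / δ)))) ^ 2} := by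
  have hexp : Real.exp (-Real.log (2 / δ)) = δ / 2 := by
    rw [Real.exp_neg, Real.exp_log (by positivity), inv_div]
  have hpos : ∀ n : ℕ, 1 ≤ n + 1 := fun n => n.succ_pos
  have hC : 0 < seqC γ lam k hk :=
    seqC_pos hγ (fun i hi => (by positivity : 0 < (1 + ε) * L).trans_le (hlam i hi)) hk
  have hregret := ofReal_one_sub_le_measure_sqrt_sum_le hcl hcv (f := f) (N := k) (ε := ε)
    (g := fun n => γ (n + 1)) (l := fun n => lam (n + 1)) (Y := fun n ω j => ξs (n + 1) j ω)
    (fun n => measurable_pi_iff.2 (hmeas (n + 1) (hpos n)))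
    (hind.precomp (g := fun n : ℕ => (⟨n + 1, hpos n⟩ : Set.Ici 1)) fun a b hab =>
      Nat.succ_injective (congrArg Subtype.val hab))
    (measurable_past_iterate hcl hcv hx₁ huhat) (measurable_batchMean huhat) (fun n ω => rfl)
    (fun n z => hnoise (n + 1) (hpos n) z z.2) (fun n z => hsub (n + 1) (hpos n) z z.2)
    hp1 hp2 hs (fun n => (hγ (n + 1) (hpos n)).le) hL hε (fun n => hlam (n + 1) (hpos n)) hC
    (fun n hn => mul_le_seqC hk (Finset.mem_Icc.2 ⟨hpos n, hn⟩)) hy hymin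
    (Real.log_pos ((one_lt_div hδ0).2 hδ2))
  rw [hexp, add_halves] at hregret
  refine hregret.trans (measure_mono fun ω hω => ?_)
  rw [seqA, seqB, sum_Icc_one_eq_sum_range, sum_Icc_one_eq_sum_range]
  exact map_average_sub_le_of_sqrt_sum_le
    (convexOn_of_forall_exists_isSubgradientWithin hcv fun x hx => ⟨_, hsub 1 le_rfl x hx⟩) hk
    (fun i _ => iterate_mem hcl hcv hx₁ i ω) (hγ k hk) hγ_anti
    (fun i _ => hymin _ (iterate_mem hcl hcv hx₁ i ω)) hω

theorem mainTheorem5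
    {H : Type*} [NormedAddCommGroup H] [InnerProductSpace ℝ H] [CompleteSpace H]
    [TopologicalSpace.SeparableSpace H] [MeasurableSpace H] [BorelSpace H]
    {Ξ : Type*} [MeasurableSpace Ξ]
    {Ω : Type*} [MeasurableSpace Ω] (P : Measure Ω) [IsProbabilityMeasure P]
    -- the convex Lipschitz objective and the constraint set
    (f : H → ℝ) (L : ℝ) (hL : 0 < L) (hf_conv : ConvexOn ℝ Set.univ f)
    (hf_lip : LipschitzWith L.toNNReal f)
    (X : Set H) (hX_ne : X.Nonempty) (hX_closed : IsClosed X) (hX_conv : Convex ℝ X)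
    -- the stochastic subgradient oracle on `X`
    (ξ : Ω → Ξ) (hξ : Measurable ξ) (uhat : H → Ξ → H)
    (huhat_meas : Measurable (fun z : X × Ξ => uhat z.1 z.2))
    (huhat_int : ∀ x ∈ X, Integrable (fun ω => uhat x (ξ ω)) P)
    (huhat_subgrad : ∀ x ∈ X, ∫ ω, uhat x (ξ ω) ∂P ∈ CSSGM.subdifferential f x)
    -- bounded moments of order `p` of the noise
    (p σ : ℝ) (hp1 : 1 < p) (hp2 : p ≤ 2) (hσ : 0 ≤ σ)
    (hnoise : ∀ x ∈ X,
      ∫⁻ ω, ‖uhat x (ξ ω) - ∫ ω', uhat x (ξ ω') ∂P‖ₑ ^ p ∂P ≤ ENNReal.ofReal (σ ^ p))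
    -- the minibatch of size `m` and its noise level `σm`
    (m : ℕ) (hm : 1 ≤ m) (σm : ℝ) (hσm : 0 ≤ σm)
    (hbatch_noise : ∀ x ∈ X,
      ∫⁻ z, ‖CSSGM.batchMean uhat x z -
          ∫ z', CSSGM.batchMean uhat x z' ∂(Measure.pi fun _ : Fin m => P.map ξ)‖ₑ ^ p
        ∂(Measure.pi fun _ : Fin m => P.map ξ) ≤ ENNReal.ofReal (σm ^ p))
    -- the draws: copies of `ξ`, independent within each batch and across batches
    (ξs : ℕ → Fin m → Ω → Ξ) (hξs_meas : ∀ k, 1 ≤ k → ∀ j, Measurable (ξs k j))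
    (hξs_copy : ∀ k, 1 ≤ k → ∀ j, IdentDistrib (ξs k j) ξ P P)
    (hξs_indep : ∀ k, 1 ≤ k → iIndepFun (fun j => ξs k j) P)
    (hξs_batch_indep : iIndepFun (fun (k : Set.Ici (1 : ℕ)) (ω : Ω) (j : Fin m) => ξs k j ω) P)
    -- step sizes, clipping levels and the initial point
    (γ lam : ℕ → ℝ) (hγ_pos : ∀ k, 1 ≤ k → 0 < γ k) (hγ_dec : ∀ k, 1 ≤ k → γ (k + 1) ≤ γ k)
    (ε : ℝ) (hε : 0 < ε) (hlam : ∀ k, 1 ≤ k → (1 + ε) * L ≤ lam k)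
    (x₁ : H) (hx₁ : x₁ ∈ X)
    -- a minimizer and the minimum of `f` on `X`
    (xs : H) (hxs : xs ∈ X) (hxs_min : ∀ y ∈ X, f xs ≤ f y)
    (fs : ℝ) (hfs : IsLeast (f '' X) fs)
    (δ : ℝ) (hδ0 : 0 < δ) (hδ1 : δ ≤ 2 / Real.exp 1)
    (k : ℕ) (hk : 1 ≤ k) :
    ENNReal.ofReal (1 - δ) ≤
      P {ω | f (CSSGM.avgIterate X uhat γ lam x₁ ξs k ω) - fs ≤
        1 / (2 * k * γ k) *
          (‖x₁ - xs‖ + CSSGM.seqA p ε σm γ lam k + CSSGM.seqB p L σm γ lam k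
            + 8 / 3 * (CSSGM.seqC γ lam k hk + CSSGM.seqD γ lam k hk) * Real.log (2 / δ)
            + (√(CSSGM.seqB p L σm γ lam k) + √(CSSGM.seqE p L σm γ lam k))
              * √(Real.log (2 / δ))) ^ 2} := by
  have : SecondCountableTopology H := UniformSpace.secondCountable_of_separable H
  have huhat : ∀ x ∈ X, Measurable (uhat x) := fun x hx =>
    huhat_meas.comp (measurable_prodMk_left (x := (⟨x, hx⟩ : X)))
  have horacle : ∀ i, 1 ≤ i → ∀ x ∈ X,
      HasBoundedNoise (fun ω => batchMean uhat x fun j => ξs i j ω) L p σm P := fun i hi x hx =>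
    hasBoundedNoise_batchMean (huhat x hx) (huhat_int x hx) (hξs_copy i hi) hm (hξs_indep i hi)
      ((norm_le_of_mem_subdifferential hf_lip (huhat_subgrad x hx)).trans_eq
        (Real.coe_toNNReal L hL.le)) (hbatch_noise x hx)
  have hsub : ∀ i, 1 ≤ i → ∀ x ∈ X,
      IsSubgradientWithin f X x (∫ ω, batchMean uhat x (fun j => ξs i j ω) ∂P) :=
    fun i hi x hx y _ =>
      integral_batchMean (huhat x hx) (huhat_int x hx) (hξs_copy i hi) hm ▸ huhat_subgrad x hx y
  have hlam0 : ∀ i, 1 ≤ i → 0 < lam i := fun i hi =>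
    (by positivity : 0 < (1 + ε) * L).trans_le (hlam i hi)
  have hlog : 1 ≤ Real.log (2 / δ) := one_le_log_two_div hδ0 hδ1
  have hδ2 : δ < 2 := (one_lt_div hδ0).1 ((Real.log_pos_iff (by positivity)).1 (by linarith))
  obtain rfl : fs = f xs :=
    hfs.unique ⟨Set.mem_image_of_mem f hxs, Set.forall_mem_image.2 hxs_min⟩
  refine (mainTheorem5_general hX_closed hX_conv huhat_meas hξs_meas hξs_batch_indep hL hp1.le hp2
    hσm horacle hsub hγ_pos (antitoneOn_nat_Ici_of_succ_le hγ_dec) hε hlam hx₁ hxs hxs_min hδ0 hδ2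
    hk).trans (measure_mono (Set.ofPred_subset_ofPred.2 fun ω hω => hω.trans ?_))
  exact mul_le_mul_of_nonneg_left
    (sq_radius_le hε.le hL.le hσm hγ_pos hlam0 hk (norm_nonneg _) hlog)
    (one_div_nonneg.2 (mul_nonneg (by positivity) (hγ_pos k hk).le))
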